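/- Let $X$ be a complex Banach space and let $T$ be a bounded linear operator on $X$. Write $\mathcal L(X)$ for the algebra of bounded linear operators on $X$, $\mathcal K(X)$ for the ideal of compact operators, and $[S]$ for the class of $S$ in the Calkin algebra $\mathcal L(X)/\mathcal K(X)$. Let $$\sigma_{\ell e}(T)=\{\lambda\in\mathbb C:[T-\lambda]\text{ is not left-invertible in }\mathcal L(X)/\mathcal K(X)\},$$ $$\sigma_e(T)=\{\lambda\in\mathbb C:[T-\lambda]\text{ is not invertible in }\mathcal L(X)/\mathcal K(X)\}$$ be the left-essential and the essential spectrum of $T$, let $$\sigma_{\ell F}(T)=\{\lambda\in\mathbb C: \text{it is not the case that } \operatorname{Ran}(T-\lambda)\text{ is closed and }\dim\operatorname{Ker}(T-\lambda)<\infty\}$$ be the set of $\lambda$ for which $T-\lambda$ is not left-Fredholm, and let $\sigma_p(T^*)$ be the set of eigenvalues of the adjoint $T^*:X^*\to X^*$, $T^*f=f\circ T$. Then: 1. If $\Omega\subset\mathbb C$ is a non-empty connected open set with $\Omega\setminus\sigma_p(T^*)\neq\varnothing$, then $\sigma_{\ell e}(T)\cap\overline\Omega\neq\varnothing$ if and only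 if $\sigma_e(T)\cap\overline\Omega\neq\varnothing$, and likewise $\sigma_{\ell F}(T)\cap\overline\Omega\neq\varnothing$ if and only if $\sigma_e(T)\cap\overline\Omega\neq\varnothing$. 2. If $\sigma_p(T^*)$ has empty interior, then $\sigma_{\ell e}(T)=\sigma_{\ell F}(T)=\sigma_e(T)$. 3. If $T$ is recurrent, that is, if the set of all $x\in X$ for which there is a strictly increasing sequence $(k_n)$ of natural numbers with $T^{k_n}x\to x$ is dense in $X$, then $\sigma_{\ell e}(T)=\sigma_{\ell F}(T)=\sigma_e(T)$. -/

import Mathlib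

open Filter Topology

noncomputable section

namespace EssentialSpectrum

variable {X : Type*} [NormedAddCommGroup X] [NormedSpace ℂ X]

variable (X) in
/-- The ideal `𝓚(X)` of all compact operators in the algebra `𝓛(X)` of bounded linear operators. -/
def compactIdeal : Ideal (X →L[ℂ] X) where
  carrier := {K | IsCompactOperator K}
  add_mem' hK hL := IsCompactOperator.add hK hL
  zero_mem' := isCompactOperator_zero
  smul_mem' S _ hK := IsCompactOperator.clm_comp hK S

/-- The ideal of compact operators is two-sided. -/
instance compactIdeal_isTwoSided : (compactIdeal X).IsTwoSided where
  mul_mem_of_left S hK := IsCompactOperator.comp_clm hK S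

variable (X) in
/-- The Calkin algebra `𝓛(X) / 𝓚(X)`, as a quotient ring. -/
abbrev CalkinAlgebra : Type _ := (X →L[ℂ] X) ⧸ compactIdeal X

/-- The class `[T]` of the operator `T` in the Calkin algebra. -/
def calkinMk (T : X →L[ℂ] X) : CalkinAlgebra X := Ideal.Quotient.mk (compactIdeal X) T

/-- The left-essential spectrum `σ_ℓe(T)`: all `z` such that `[T - z]` is not left-invertible in the
Calkin algebra. -/
def leftEssentialSpectrum (T : X →L[ℂ] X) : Set ℂ :=
  {z | ¬ ∃ b : CalkinAlgebra X, b * calkinMk (T - z • (1 : X →L[ℂ] X)) = 1}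

/-- The essential spectrum `σ_e(T)`: all `z` such that `[T - z]` is not invertible in the
Calkin algebra. -/
def essentialSpectrum (T : X →L[ℂ] X) : Set ℂ :=
  {z | ¬ IsUnit (calkinMk (T - z • (1 : X →L[ℂ] X)))}

/-- Left-Fredholm operators in the sense of semi-Fredholm theory: the range is closed and the kernel
is finite-dimensional (the range is not required to be complemented). -/
def IsLeftFredholm (S : X →L[ℂ] X) : Prop :=
  IsClosed (Set.range S) ∧ FiniteDimensional ℂ S.ker

/-- All `z` such that `T - z` is not left-Fredholm. -/
def leftFredholmSpectrum (T : X →L[ℂ] X) : Set ℂ :=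
  {z | ¬ IsLeftFredholm (T - z • (1 : X →L[ℂ] X))}

/-- The Banach space adjoint `T* : X* → X*`, `T* f = f ∘ T`. -/
def dualOperator (T : X →L[ℂ] X) : StrongDual ℂ X →L[ℂ] StrongDual ℂ X :=
  ContinuousLinearMap.precomp ℂ T

/-- The point spectrum of a bounded operator, i.e. the set of its eigenvalues. -/
def pointSpectrum (T : X →L[ℂ] X) : Set ℂ :=
  {z | Module.End.HasEigenvalue (T : X →ₗ[ℂ] X) z}

/-- The set `Rec(T)` of recurrent vectors: all `x` such that `T^{k_n} x → x` for some strictly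
increasing sequence `(k_n)` of natural numbers. -/
def recurrentVectors (T : X →L[ℂ] X) : Set X :=
  {x | ∃ k : ℕ → ℕ, StrictMono k ∧ Tendsto (fun n => (T ^ k n) x) atTop (𝓝 x)}

/-- An operator is recurrent if its set of recurrent vectors is dense. -/
def IsRecurrent (T : X →L[ℂ] X) : Prop := Dense (recurrentVectors T)

end EssentialSpectrum

end

/-! Always `σ_ℓF ⊆ σ_ℓe ⊆ σ_e`, so everything rests on a point `z ∈ σ_e` at which `T - z` is
left-Fredholm. The key fact, `eventually_not_finiteDimensional`, is that `Ker (T - w)*` is then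
infinite-dimensional for all `w` near `z`. Let `M` be a closed complement of `Ker (T - z)`. If `Ker
(T - w)*` is finite-dimensional, so is the annihilator of `(T - w) M`. For `w` close to `z`, the
annihilator of `Ran (T - z)` is uniformly close to it, hence finite-dimensional too. Then `T - z` is
Fredholm, so `z ∉ σ_e`.

Such a `z` is therefore interior to `σ_p(T*)`, which gives claim 2. For claim 3, recurrence confines
`σ_p(T*)` to the unit circle. Claim 1 is a connectedness argument on the closure of `Ω`. -/

namespace EssentialSpectrum

/-! ### Finite-dimensional spaces of functionals -/

section Dual

variable {X : Type*} [NormedAddCommGroup X] [NormedSpace ℂ X]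

/-- A finite-dimensional space of functionals is almost normed by finitely many vectors. -/
theorem exists_finite_norming (G : Submodule ℂ (StrongDual ℂ X)) [FiniteDimensional ℂ G] :
    ∃ t : Set X, t.Finite ∧ (∀ y ∈ t, ‖y‖ ≤ 1) ∧ ∀ g ∈ G, g ≠ 0 → ∃ y ∈ t, ‖g‖ / 2 ≤ ‖g y‖ := by
  -- A `1/8`-net of the unit sphere, nearly normed to `3/4`, leaves `3/4 - 1/8 ≥ 1/2`.
  obtain ⟨s, hs, hfin, hcov⟩ :=
    (isCompact_sphere (0 : G) 1).finite_cover_balls (e := 1 / 8) (by norm_num)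
  have key : ∀ g : G, ∃ y : X, ‖y‖ ≤ 1 ∧ (g ∈ s → 3 / 4 ≤ ‖(g : StrongDual ℂ X) y‖) := by
    intro g
    by_cases hg : g ∈ s
    · have h1 : ‖(g : StrongDual ℂ X)‖ = 1 := by
        rw [← dist_zero_right]; exact Metric.mem_sphere.mp (hs hg)
      obtain ⟨y, hy, hgy⟩ := ContinuousLinearMap.exists_lt_apply_of_lt_opNorm
        (g : StrongDual ℂ X) (r := 3 / 4) (by rw [h1]; norm_num)
      exact ⟨y, hy.le, fun _ => hgy.le⟩
    · exact ⟨0, by simp, fun h => absurd h hg⟩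
  choose y hy1 hy2 using key
  refine ⟨y '' s, hfin.image y, ?_, ?_⟩
  · rintro _ ⟨g, -, rfl⟩
    exact hy1 g
  · intro g hg hg0
    have hpos : 0 < ‖g‖ := norm_pos_iff.mpr hg0
    let u : G := ((‖g‖ : ℂ)⁻¹) • ⟨g, hg⟩
    have hu : u ∈ Metric.sphere (0 : G) 1 := by
      rw [Metric.mem_sphere, Subtype.dist_eq]
      change dist (((‖g‖ : ℂ)⁻¹) • g) 0 = 1
      rw [dist_zero_right, norm_smul, norm_inv, Complex.norm_real, norm_norm,
        inv_mul_cancel₀ hpos.ne']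
    obtain ⟨v, hv, huv⟩ := Set.mem_iUnion₂.mp (hcov hu)
    refine ⟨y v, Set.mem_image_of_mem y hv, ?_⟩
    have h1 := hy2 v hv
    have h2 : ‖((u : StrongDual ℂ X) - v) (y v)‖ ≤ 1 / 8 := by
      have h3 : ‖(u : StrongDual ℂ X) - v‖ < 1 / 8 := by
        rw [← dist_eq_norm]; exact Metric.mem_ball.mp huv
      calc _ ≤ ‖(u : StrongDual ℂ X) - v‖ * ‖y v‖ := ContinuousLinearMap.le_opNorm _ _
        _ ≤ (1 / 8) * 1 := by gcongr; exact hy1 v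
        _ = 1 / 8 := by norm_num
    have h4 : ‖(u : StrongDual ℂ X) (y v)‖ = ‖g‖⁻¹ * ‖g (y v)‖ := by simp [u]
    have h5 : 1 / 2 ≤ ‖(u : StrongDual ℂ X) (y v)‖ := by
      have := norm_sub_norm_le ((v : StrongDual ℂ X) (y v)) ((u : StrongDual ℂ X) (y v))
      rw [norm_sub_rev] at this
      rw [sub_apply] at h2
      linarith
    rw [h4, inv_mul_eq_div, le_div_iff₀ hpos] at h5
    linarith

/-- A space of functionals on which finitely many evaluations are jointly injective is
finite-dimensional. -/
theorem finiteDimensional_of_finite_separating (V : Submodule ℂ (StrongDual ℂ X)) {t : Set X}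
    (ht : t.Finite) (h : ∀ f ∈ V, (∀ y ∈ t, f y = 0) → f = 0) : FiniteDimensional ℂ V := by
  have := ht.to_subtype
  let e : V →ₗ[ℂ] (t → ℂ) :=
    { toFun := fun f y => (f : StrongDual ℂ X) y
      map_add' := fun _ _ => rfl
      map_smul' := fun _ _ => rfl }
  refine Module.Finite.of_injective e fun f g hfg => Subtype.ext (sub_eq_zero.mp ?_)
  refine h _ (V.sub_mem f.2 g.2) fun y hy => ?_
  exact sub_eq_zero.mpr (congrFun hfg ⟨y, hy⟩)

/-- A space of functionals that is uniformly close to a finite-dimensional one is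
finite-dimensional. -/
theorem finiteDimensional_of_close (V G : Submodule ℂ (StrongDual ℂ X)) [FiniteDimensional ℂ G]
    (h : ∀ f ∈ V, ∃ g ∈ G, ‖f - g‖ ≤ ‖f‖ / 4) : FiniteDimensional ℂ V := by
  obtain ⟨t, ht, ht1, hnorm⟩ := exists_finite_norming G
  refine finiteDimensional_of_finite_separating V ht fun f hf hft => ?_
  obtain ⟨g, hg, hfg⟩ := h f hf
  have htri : ‖f‖ ≤ ‖f - g‖ + ‖g‖ := by simpa using norm_add_le (f - g) g
  rcases eq_or_ne g 0 with rfl | hg0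
  · rw [← norm_le_zero_iff]
    rw [norm_zero] at htri
    linarith
  -- As `f y = 0`, `‖g‖ / 2 ≤ ‖(f - g) y‖ ≤ ‖f‖ / 4`, so `‖f‖ ≤ 3‖f‖ / 4`.
  obtain ⟨y, hy, hgy⟩ := hnorm g hg hg0
  have h1 : ‖g y‖ ≤ ‖f - g‖ := by
    have := (f - g).unit_le_opNorm y (ht1 y hy)
    rwa [sub_apply, hft y hy, zero_sub, norm_neg] at this
  rw [← norm_le_zero_iff]
  linarith

/-- The functionals annihilating the range of `1 + K`, with `K` compact, form a
finite-dimensional space. -/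
theorem finiteDimensional_of_add_comp_eq_zero {K : X →L[ℂ] X} (hK : IsCompactOperator K)
    (V : Submodule ℂ (StrongDual ℂ X)) (hV : ∀ f ∈ V, ∀ x, f (x + K x) = 0) :
    FiniteDimensional ℂ V := by
  obtain ⟨C, hC, hKC⟩ := hK.image_closedBall_subset_compact (f := K.toLinearMap) 1
  obtain ⟨t, -, ht, hcov⟩ := hC.finite_cover_balls (e := 1 / 4) (by norm_num)
  refine finiteDimensional_of_finite_separating V ht fun f hf hft => ?_
  have hle : ‖f‖ ≤ ‖f‖ / 4 := by
    refine ContinuousLinearMap.opNorm_le_of_unit_norm (by positivity) fun x hx => ?_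
    have hxC : K x ∈ C := hKC ⟨x, by simp [hx], rfl⟩
    obtain ⟨y, hy, hxy⟩ := Set.mem_iUnion₂.mp (hcov hxC)
    have h1 : f x = -f (K x - y) := by
      have := hV f hf x
      rw [map_add] at this
      rw [map_sub, hft y hy, sub_zero]
      exact eq_neg_of_add_eq_zero_left this
    rw [h1, norm_neg]
    have h2 : ‖K x - y‖ ≤ 1 / 4 := by rw [← dist_eq_norm]; exact (Metric.mem_ball.mp hxy).le
    calc _ ≤ ‖f‖ * ‖K x - y‖ := f.le_opNorm _
      _ ≤ ‖f‖ * (1 / 4) := by gcongr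
      _ = ‖f‖ / 4 := by ring
  rw [← norm_le_zero_iff]
  linarith

/-- A closed subspace whose annihilator is finite-dimensional has finite codimension. -/
theorem finiteDimensional_quotient_of_annihilator (p : Submodule ℂ X) (hp : IsClosed (p : Set X))
    (V : Submodule ℂ (StrongDual ℂ X)) [FiniteDimensional ℂ V]
    (hV : ∀ f : StrongDual ℂ X, (∀ x ∈ p, f x = 0) → f ∈ V) : FiniteDimensional ℂ (X ⧸ p) := by
  have hp' : IsClosed (p.toAddSubgroup : Set X) := hp
  -- The dual of `X ⧸ p` embeds in `V` via `j`, and `X ⧸ p` embeds in its bidual by Hahn–Banach,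
  -- since `p` is closed.
  let e : (X ⧸ p) →ₗ[ℂ] Module.Dual ℂ (StrongDual ℂ (X ⧸ p)) :=
    { toFun := fun q => { toFun := fun f => f q, map_add' := fun _ _ => rfl,
                          map_smul' := fun _ _ => rfl }
      map_add' := fun a b => LinearMap.ext fun f => map_add f a b
      map_smul' := fun a b => LinearMap.ext fun f => map_smul f a b }
  let j : StrongDual ℂ (X ⧸ p) →ₗ[ℂ] V :=
    { toFun := fun f => ⟨f.comp p.mkQL, hV _ fun x hx => by
        have : p.mkQ x = 0 := by simpa using hx
        simp [this]⟩
      map_add' := fun _ _ => rfl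
      map_smul' := fun _ _ => rfl }
  have hj : Function.Injective j := by
    intro f g hfg
    ext q
    obtain ⟨x, rfl⟩ := p.mkQ_surjective q
    exact DFunLike.congr_fun (congrArg Subtype.val hfg) x
  have := isNoetherian_of_isNoetherianRing_of_finite ℂ V
  have : FiniteDimensional ℂ (StrongDual ℂ (X ⧸ p)) := Module.Finite.of_injective j hj
  refine FiniteDimensional.of_injective e ?_
  rw [← LinearMap.ker_eq_bot, LinearMap.ker_eq_bot']
  intro q hq
  exact SeparatingDual.eq_zero_of_forall_dual_eq_zero (R := ℂ) fun f => DFunLike.congr_fun hq f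

end Dual

/-! ### Invertibility modulo compact operators -/

section Calkin

variable {X : Type*} [NormedAddCommGroup X] [NormedSpace ℂ X]

theorem calkinMk_eq_iff {S R : X →L[ℂ] X} :
    calkinMk S = calkinMk R ↔ IsCompactOperator (S - R) :=
  Ideal.Quotient.eq

theorem calkinMk_mul (S R : X →L[ℂ] X) : calkinMk (S * R) = calkinMk S * calkinMk R := rfl

theorem calkinMk_one : calkinMk (1 : X →L[ℂ] X) = 1 := rfl

theorem calkinMk_surjective (b : CalkinAlgebra X) : ∃ R : X →L[ℂ] X, calkinMk R = b :=
  Ideal.Quotient.mk_surjective b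

theorem isCompactOperator_of_hasFiniteRange {K : X →L[ℂ] X}
    (hK : FiniteDimensional ℂ K.range) : IsCompactOperator K := by
  have h : IsCompactOperator (id : K.range → K.range) :=
    (isCompactOperator_id_iff_finiteDimensional (𝕜 := ℂ)).mpr hK
  exact (h.comp_clm K.rangeRestrict).clm_comp K.range.subtypeL

open LinearMap.FiniteRangeSetoid in
theorem finiteDimensional_range_sub_one {S R : X →L[ℂ] X}
    (h : S.toLinearMap ∘ₗ R.toLinearMap ≈ LinearMap.id) :
    FiniteDimensional ℂ (S * R - 1).range :=
  Module.Finite.of_fg (equiv_iff_hasFiniteRange.mp h)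

/-- Fredholm operators are invertible modulo the compact operators. -/
theorem isUnit_calkinMk_of_isFredholm {S : X →L[ℂ] X} (hS : S.IsFredholm) :
    IsUnit (calkinMk S) := by
  obtain ⟨R, hl, hr⟩ := hS.exists_isQuasiInverse
  refine isUnit_iff_exists.mpr ⟨calkinMk R, ?_, ?_⟩
  · rw [← calkinMk_mul, ← calkinMk_one, calkinMk_eq_iff]
    exact isCompactOperator_of_hasFiniteRange (finiteDimensional_range_sub_one hr)
  · rw [← calkinMk_mul, ← calkinMk_one, calkinMk_eq_iff]
    exact isCompactOperator_of_hasFiniteRange (finiteDimensional_range_sub_one hl)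

/-- An operator that is left-invertible modulo the compact operators is bounded below on each
closed subspace that meets its kernel trivially. -/
theorem exists_bound_below {S R K : X →L[ℂ] X} (hK : IsCompactOperator K) (hRS : R * S = 1 + K)
    (M : Submodule ℂ X) (hM : IsClosed (M : Set X)) (hMS : ∀ x ∈ M, S x = 0 → x = 0) :
    ∃ c > 0, ∀ x ∈ M, c * ‖x‖ ≤ ‖S x‖ := by
  by_contra! hcon
  have hex : ∀ n : ℕ, ∃ x ∈ M, ‖x‖ = 1 ∧ ‖S x‖ ≤ 1 / ((n : ℝ) + 1) := by
    intro n
    obtain ⟨x, hxM, hx⟩ := hcon (1 / ((n : ℝ) + 1)) (by positivity)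
    have hx0 : x ≠ 0 := by rintro rfl; simp at hx
    have hpos : 0 < ‖x‖ := norm_pos_iff.mpr hx0
    refine ⟨((‖x‖ : ℂ)⁻¹) • x, M.smul_mem _ hxM, by simp [norm_smul, hpos.ne'], ?_⟩
    rw [map_smul, norm_smul, norm_inv, Complex.norm_real, norm_norm, inv_mul_le_iff₀ hpos]
    linarith
  choose x hxM hx1 hxS using hex
  have hS0 : Tendsto (fun n => S (x n)) atTop (𝓝 0) :=
    squeeze_zero_norm hxS tendsto_one_div_add_atTop_nhds_zero_nat
  obtain ⟨C, hC, hKC⟩ := hK.image_closedBall_subset_compact (f := K.toLinearMap) 1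
  obtain ⟨y, -, φ, hφ, hy⟩ := hC.tendsto_subseq (x := fun n => K (x n))
    fun n => hKC ⟨x n, by simp [hx1], rfl⟩
  -- Since `x = R S x - K x`, compactness of `K` makes the almost-null unit vectors converge along a
  -- subsequence.
  have hxy : Tendsto (fun n => x (φ n)) atTop (𝓝 (-y)) := by
    have h1 : Tendsto (fun n => R (S (x (φ n))) - K (x (φ n))) atTop (𝓝 (R 0 - y)) :=
      ((R.continuous.tendsto 0).comp (hS0.comp hφ.tendsto_atTop)).sub hy
    rw [map_zero, zero_sub] at h1
    refine h1.congr fun n => ?_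
    have := DFunLike.congr_fun hRS (x (φ n))
    change R (S (x (φ n))) = x (φ n) + K (x (φ n)) at this
    rw [this, add_sub_cancel_right]
  have hyM : -y ∈ M := hM.mem_of_tendsto hxy (Eventually.of_forall fun n => hxM _)
  have hSy : S (-y) = 0 :=
    tendsto_nhds_unique ((S.continuous.tendsto _).comp hxy) (hS0.comp hφ.tendsto_atTop)
  have h1 : ‖-y‖ = 1 :=
    tendsto_nhds_unique hxy.norm (by simpa only [hx1] using tendsto_const_nhds)
  rw [hMS _ hyM hSy, norm_zero] at h1
  exact zero_ne_one h1

/-- On this kernel `-K` is the identity, which is thus compact; Riesz's theorem applies. -/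
theorem finiteDimensional_ker_one_add {K : X →L[ℂ] X} (hK : IsCompactOperator K) :
    FiniteDimensional ℂ (1 + K).ker := by
  have hx : ∀ x ∈ (1 + K).ker, K x = -x := fun x hx =>
    (neg_eq_of_add_eq_zero_right (show x + K x = 0 from hx)).symm
  have hmem : ∀ x ∈ (1 + K).ker, K x ∈ (1 + K).ker := fun x h => by
    rw [hx x h]
    exact neg_mem h
  have h := (hK.restrict (f := K.toLinearMap) hmem (1 + K).isClosed_ker).neg
  refine FiniteDimensional.of_isCompactOperator_id (𝕜 := ℂ) ((congrArg IsCompactOperator ?_).mp h)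
  funext x
  refine Subtype.ext ?_
  change -K x = x
  rw [hx x x.2, neg_neg]

theorem isUnit_one_sub_smul [CompleteSpace X] (R : X →L[ℂ] X) :
    ∀ᶠ z : ℂ in 𝓝 0, IsUnit (1 - z • R) := by
  have h : Tendsto (fun z : ℂ => 1 - z • R) (𝓝 0) (𝓝 1) := by
    have : Continuous fun z : ℂ => 1 - z • R := by fun_prop
    simpa using this.tendsto 0
  exact h.eventually (Units.isOpen.mem_nhds isUnit_one)

/-- If `S R ≡ 1` modulo compacts, then `S - z ≡ S (1 - z R)`, whose second factor is already
invertible in `𝓛(X)` for small `z`. -/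
theorem isUnit_calkinMk_sub_smul [CompleteSpace X] {S : X →L[ℂ] X} (hS : IsUnit (calkinMk S)) :
    ∀ᶠ z : ℂ in 𝓝 0, IsUnit (calkinMk (S - z • 1)) := by
  obtain ⟨b, hSb, -⟩ := isUnit_iff_exists.mp hS
  obtain ⟨R, rfl⟩ := calkinMk_surjective b
  filter_upwards [isUnit_one_sub_smul R] with z hz
  have hz' : IsUnit (calkinMk (1 - z • R)) := hz.map (Ideal.Quotient.mk (compactIdeal X))
  have : calkinMk (S - z • 1) = calkinMk S * calkinMk (1 - z • R) := by
    rw [← calkinMk_mul, calkinMk_eq_iff]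
    rw [← calkinMk_mul, ← calkinMk_one, calkinMk_eq_iff] at hSb
    have := hSb.smul z
    refine (congrArg IsCompactOperator ?_).mp this
    change ⇑(z • (S * R - 1)) = _
    congr 1
    rw [mul_sub, mul_one, mul_smul_comm, smul_sub]
    abel
  rw [this]
  exact hS.mul hz'

theorem finiteDimensional_ker_dualOperator {S : X →L[ℂ] X} (hS : IsUnit (calkinMk S)) :
    FiniteDimensional ℂ (dualOperator S).ker := by
  obtain ⟨b, hSb, -⟩ := isUnit_iff_exists.mp hS
  obtain ⟨R, rfl⟩ := calkinMk_surjective b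
  rw [← calkinMk_mul, ← calkinMk_one, calkinMk_eq_iff] at hSb
  refine finiteDimensional_of_add_comp_eq_zero (K := S * R - 1) hSb _ fun f hf x => ?_
  have : f (S (R x)) = 0 := DFunLike.congr_fun (show f.comp S = 0 from hf) (R x)
  simpa using this

end Calkin

/-! ### Left-Fredholm operators and their perturbations -/

section Operators

variable {X : Type*} [NormedAddCommGroup X] [NormedSpace ℂ X]

theorem exists_isClosed_isCompl (p : Submodule ℂ X) [FiniteDimensional ℂ p] :
    ∃ M : Submodule ℂ X, IsClosed (M : Set X) ∧ IsCompl p M :=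
  (Submodule.ClosedComplemented.of_finiteDimensional p).exists_isClosed_isCompl

theorem eq_zero_of_mem_isCompl_ker {S : X →L[ℂ] X} {M : Submodule ℂ X} (hM : IsCompl S.ker M) :
    ∀ x ∈ M, S x = 0 → x = 0 := fun x hxM hx =>
  Submodule.disjoint_def.mp hM.disjoint x hx hxM

theorem range_domRestrict_of_isCompl_ker {S : X →L[ℂ] X} {M : Submodule ℂ X}
    (hM : IsCompl S.ker M) : Set.range (S.domRestrict M) = Set.range S := by
  refine Set.Subset.antisymm (by rintro _ ⟨x, rfl⟩; exact ⟨x, rfl⟩) ?_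
  rintro _ ⟨x, rfl⟩
  obtain ⟨k, hk, m, hm, rfl⟩ := Submodule.mem_sup.mp (hM.sup_eq_top ▸ Submodule.mem_top (x := x))
  refine ⟨⟨m, hm⟩, ?_⟩
  have hk0 : S k = 0 := hk
  simp [hk0]

theorem domRestrict_injective_of_isCompl_ker {S : X →L[ℂ] X} {M : Submodule ℂ X}
    (hM : IsCompl S.ker M) : Function.Injective (S.domRestrict M) :=
  (injective_iff_map_eq_zero _).mpr fun x hx =>
    Subtype.ext (eq_zero_of_mem_isCompl_ker hM x x.2 hx)

/-- If `S` is bounded below by `c` on `M` and `S - z` is a small perturbation of `S`, then each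
functional vanishing on the range of `S` is close to one vanishing on `(S - z) M`. -/
theorem exists_close_annihilator {S : X →L[ℂ] X} {M : Submodule ℂ X} {c : ℝ} (hc : 0 < c)
    (hSc : ∀ x ∈ M, c * ‖x‖ ≤ ‖S x‖) {z : ℂ} (hz : ‖z‖ ≤ c / 5) {f : StrongDual ℂ X}
    (hf : ∀ x, f (S x) = 0) :
    ∃ g : StrongDual ℂ X, (∀ x ∈ M, g ((S - z • 1) x) = 0) ∧ ‖f - g‖ ≤ ‖f‖ / 4 := by
  let p : Submodule ℂ X := M.map (S - z • (1 : X →L[ℂ] X)).toLinearMap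
  -- On `M`, `|f((S - z)x)| = |z f(x)| ≤ (c/5)‖f‖‖x‖`, while `‖(S - z)x‖ ≥ (4c/5)‖x‖`.
  have hbound : ‖f.domRestrict p‖ ≤ ‖f‖ / 4 := by
    refine ContinuousLinearMap.opNorm_le_bound _ (by positivity) ?_
    rintro ⟨_, x, hx, rfl⟩
    change ‖f (S x - z • x)‖ ≤ ‖f‖ / 4 * ‖S x - z • x‖
    have h1 : ‖f (S x - z • x)‖ ≤ c / 5 * (‖f‖ * ‖x‖) := by
      rw [map_sub, hf, zero_sub, norm_neg, map_smul, norm_smul]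
      gcongr
      exact f.le_opNorm x
    have h2 : 4 * (c / 5) * ‖x‖ ≤ ‖S x - z • x‖ := by
      have h3 := norm_sub_norm_le (S x) (z • x)
      have h4 : ‖z • x‖ ≤ c / 5 * ‖x‖ := by rw [norm_smul]; gcongr
      linarith [hSc x hx]
    calc _ ≤ c / 5 * (‖f‖ * ‖x‖) := h1
      _ = ‖f‖ / 4 * (4 * (c / 5) * ‖x‖) := by ring
      _ ≤ _ := by gcongr
  obtain ⟨h, hh, hnorm⟩ := exists_extension_norm_eq p (f.domRestrict p)
  refine ⟨f - h, fun x hx => ?_, ?_⟩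
  · have := hh ⟨_, Submodule.mem_map_of_mem hx⟩
    exact sub_eq_zero.mpr this.symm
  · rw [sub_sub_cancel, hnorm]
    exact hbound

/-- The functionals annihilating `S M` form a finite-dimensional space if the adjoint of `S` has a
finite-dimensional kernel and `M` has finite codimension. -/
theorem finiteDimensional_annihilator_map {S : X →L[ℂ] X}
    (hS : FiniteDimensional ℂ (dualOperator S).ker) {N M : Submodule ℂ X} (hNM : IsCompl N M)
    [FiniteDimensional ℂ N] :
    ∃ G : Submodule ℂ (StrongDual ℂ X), FiniteDimensional ℂ G ∧
      ∀ g : StrongDual ℂ X, g ∈ G ↔ ∀ x ∈ M, g (S x) = 0 := by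
  let G : Submodule ℂ (StrongDual ℂ X) :=
    { carrier := {g | ∀ x ∈ M, g (S x) = 0}
      add_mem' := fun {a b} ha hb x hx => by simp [ha x hx, hb x hx]
      zero_mem' := fun x _ => rfl
      smul_mem' := fun a g hg x hx => by simp [hg x hx] }
  -- An element of `G` killed by `e` vanishes on `S N` and `S M`, hence on `Ran S`.
  let e : StrongDual ℂ X →ₗ[ℂ] Module.Dual ℂ N :=
    { toFun := fun g => (g.comp S).toLinearMap.comp N.subtype
      map_add' := fun _ _ => rfl
      map_smul' := fun _ _ => rfl }
  refine ⟨G, ?_, fun g => Iff.rfl⟩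
  have hfg : G.FG := by
    refine Submodule.fg_of_fg_map_of_fg_inf_ker e (IsNoetherian.noetherian _) ?_
    have := isNoetherian_of_isNoetherianRing_of_finite ℂ (dualOperator S).ker
    refine isNoetherian_submodule.mp this _ ?_
    rintro g ⟨hgM, hgN⟩
    refine ContinuousLinearMap.ext fun x => ?_
    obtain ⟨n, hn, m, hm, rfl⟩ :=
      Submodule.mem_sup.mp (hNM.sup_eq_top ▸ Submodule.mem_top (x := x))
    have h1 : g (S n) = 0 := DFunLike.congr_fun (show e g = 0 from hgN) ⟨n, hn⟩
    have h2 : g (S m) = 0 := hgM m hm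
    change g (S (n + m)) = 0
    rw [map_add, map_add, h1, h2, add_zero]
  exact Module.Finite.of_fg hfg

variable [CompleteSpace X]

theorem IsLeftFredholm.of_leftInvertible {S : X →L[ℂ] X} {b : CalkinAlgebra X}
    (hb : b * calkinMk S = 1) : IsLeftFredholm S := by
  obtain ⟨R, rfl⟩ := calkinMk_surjective b
  rw [← calkinMk_mul, ← calkinMk_one, calkinMk_eq_iff] at hb
  have hRS : R * S = 1 + (R * S - 1) := by abel
  have hker : FiniteDimensional ℂ S.ker := by
    have := finiteDimensional_ker_one_add (K := R * S - 1) hb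
    refine Submodule.finiteDimensional_of_le (S₂ := (1 + (R * S - 1)).ker) fun x hx => ?_
    rw [← hRS]
    change R (S x) = 0
    rw [show S x = 0 from hx, map_zero]
  refine ⟨?_, hker⟩
  obtain ⟨M, hMc, hM⟩ := exists_isClosed_isCompl S.ker
  obtain ⟨c, hc, hSc⟩ :=
    exists_bound_below (K := R * S - 1) hb hRS M hMc (eq_zero_of_mem_isCompl_ker hM)
  have := hMc.completeSpace_coe
  have hanti : ∃ K, AntilipschitzWith K (S.domRestrict M) :=
    antilipschitzWith_iff_exists_mul_le_norm.mpr ⟨c, hc, fun x => hSc x x.2⟩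
  obtain ⟨K, hK⟩ := hanti
  rw [← range_domRestrict_of_isCompl_ker hM]
  exact hK.isClosed_range (S.domRestrict M).uniformContinuous

theorem exists_bound_below_of_isClosed_range {S : X →L[ℂ] X} (hS : IsClosed (Set.range S))
    {M : Submodule ℂ X} (hMc : IsClosed (M : Set X)) (hM : IsCompl S.ker M) :
    ∃ c > 0, ∀ x ∈ M, c * ‖x‖ ≤ ‖S x‖ := by
  have := hMc.completeSpace_coe
  have hanti := (S.domRestrict M).antilipschitz_of_injective_of_isClosed_range
    (domRestrict_injective_of_isCompl_ker hM) (by rwa [range_domRestrict_of_isCompl_ker hM])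
  obtain ⟨c, hc, h⟩ := antilipschitzWith_iff_exists_mul_le_norm.mp hanti
  exact ⟨c, hc, fun x hx => h ⟨x, hx⟩⟩

/-- A left-Fredholm operator whose adjoint has a finite-dimensional kernel is Fredholm. -/
theorem IsLeftFredholm.isFredholm {S : X →L[ℂ] X} (hS : IsLeftFredholm S)
    (hdual : FiniteDimensional ℂ (dualOperator S).ker) : S.IsFredholm := by
  obtain ⟨hcl, hker⟩ := hS
  have hcl' : IsClosed (S.range : Set X) := hcl
  obtain ⟨M, hMc, hM⟩ := exists_isClosed_isCompl S.ker
  have := hMc.completeSpace_coe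
  have := hcl'.completeSpace_coe
  have hM_coFG : M.CoFG := Submodule.FG.cofg_of_isCompl hM (Module.Finite.iff_fg.mp hker)
  have hran_coFG : S.range.CoFG := by
    refine finiteDimensional_quotient_of_annihilator S.range hcl' (dualOperator S).ker fun f hf => ?_
    exact ContinuousLinearMap.ext fun x => hf _ ⟨x, rfl⟩
  have hmaps : Set.MapsTo S M S.range := fun x _ => ⟨x, rfl⟩
  -- `S` restricts to an isomorphism between the closed finite-codimensional subspaces `M` and `Ran
  -- S`.
  refine .of_isInvertible_restrict hMc hcl' hmaps ?_
  refine ⟨.ofBijective (S.restrict hmaps) ?_ ?_, ?_⟩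
  · refine LinearMap.ker_eq_bot'.mpr fun x hx => Subtype.ext ?_
    exact eq_zero_of_mem_isCompl_ker hM x x.2 (congrArg Subtype.val hx)
  · refine LinearMap.range_eq_top.mpr ?_
    rintro ⟨y, hy⟩
    have hy' : y ∈ Set.range (S.domRestrict M) := by
      rw [range_domRestrict_of_isCompl_ker hM]
      exact hy
    obtain ⟨x, hx⟩ := hy'
    exact ⟨x, Subtype.ext hx⟩
  · rfl

/-- If `S` is left-Fredholm and the adjoint of some sufficiently small scalar perturbation of `S`
has a finite-dimensional kernel, then `S` is invertible modulo the compact operators. -/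
theorem IsLeftFredholm.eventually_isUnit {S : X →L[ℂ] X} (hS : IsLeftFredholm S) :
    ∀ᶠ z : ℂ in 𝓝 0, FiniteDimensional ℂ (dualOperator (S - z • 1)).ker →
      IsUnit (calkinMk S) := by
  have := hS.2
  obtain ⟨M, hMc, hM⟩ := exists_isClosed_isCompl S.ker
  obtain ⟨c, hc, hSc⟩ := exists_bound_below_of_isClosed_range hS.1 hMc hM
  filter_upwards [Metric.closedBall_mem_nhds (0 : ℂ) (show 0 < c / 5 by positivity)] with z hz hfin
  rw [mem_closedBall_zero_iff] at hz
  obtain ⟨G, hGfin, hG⟩ := finiteDimensional_annihilator_map hfin hM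
  refine isUnit_calkinMk_of_isFredholm (hS.isFredholm ?_)
  refine finiteDimensional_of_close (dualOperator S).ker G fun f hf => ?_
  obtain ⟨g, hg, hfg⟩ := exists_close_annihilator hc hSc hz
    (f := f) (fun x => DFunLike.congr_fun (show f.comp S = 0 from hf) x)
  exact ⟨g, (hG g).mpr hg, hfg⟩

end Operators

/-! ### Comparison of the spectra -/

section Spectra

variable {X : Type*} [NormedAddCommGroup X] [NormedSpace ℂ X]

theorem leftEssentialSpectrum_subset (T : X →L[ℂ] X) :
    leftEssentialSpectrum T ⊆ essentialSpectrum T := by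
  intro z hz hu
  obtain ⟨b, -, hb⟩ := isUnit_iff_exists.mp hu
  exact hz ⟨b, hb⟩

theorem dualOperator_sub_smul_apply (T : X →L[ℂ] X) (z : ℂ) (f : StrongDual ℂ X) :
    dualOperator (T - z • 1) f = dualOperator T f - z • f := by
  ext x
  simp [dualOperator]

theorem finiteDimensional_ker_of_notMem_pointSpectrum {T : X →L[ℂ] X} {z : ℂ}
    (hz : z ∉ pointSpectrum (dualOperator T)) :
    FiniteDimensional ℂ (dualOperator (T - z • 1)).ker := by
  have : (dualOperator (T - z • 1)).ker = ⊥ := by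
    refine (Submodule.eq_bot_iff _).mpr fun f hf => ?_
    by_contra hf0
    refine hz (Module.End.hasEigenvalue_of_hasEigenvector (x := f)
      (Module.End.hasEigenvector_iff.mpr ⟨Module.End.mem_eigenspace_iff.mpr ?_, hf0⟩))
    have h : dualOperator (T - z • 1) f = 0 := hf
    rw [dualOperator_sub_smul_apply] at h
    exact sub_eq_zero.mp h
  rw [this]
  infer_instance

theorem sub_smul_one_sub (T : X →L[ℂ] X) (z w : ℂ) :
    T - w • (1 : X →L[ℂ] X) = T - z • 1 - (w - z) • 1 := by
  rw [sub_smul]; abel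

/-- An eigenfunctional satisfies `f(Tⁿx) = zⁿ f(x)`; a recurrent `x` with `f x ≠ 0` forces `z^{k_n}
→ 1`. -/
theorem pointSpectrum_dualOperator_subset_sphere {T : X →L[ℂ] X} (hT : IsRecurrent T) :
    pointSpectrum (dualOperator T) ⊆ Metric.sphere 0 1 := by
  intro z hz
  obtain ⟨f, hf⟩ := Module.End.HasEigenvalue.exists_hasEigenvector hz
  have hfT : ∀ x, f (T x) = z * f x := fun x =>
    DFunLike.congr_fun (show dualOperator T f = z • f from hf.apply_eq_smul) x
  have hpow : ∀ (n : ℕ) (x : X), f ((T ^ n) x) = z ^ n * f x := by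
    intro n
    induction n with
    | zero => simp
    | succ n ih =>
      intro x
      rw [pow_succ, pow_succ]
      change f ((T ^ n) (T x)) = _
      rw [ih, hfT, mul_assoc]
  have hopen : IsOpen {x : X | f x ≠ 0} := isOpen_ne.preimage f.continuous
  have hne : {x : X | f x ≠ 0}.Nonempty := by
    by_contra h
    refine hf.2 (ContinuousLinearMap.ext fun x => ?_)
    by_contra hx
    exact h ⟨x, hx⟩
  obtain ⟨x, hx0, k, hk, hx⟩ := hT.inter_open_nonempty _ hopen hne
  have h1 : Tendsto (fun n => z ^ k n * f x) atTop (𝓝 (f x)) := by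
    simpa only [hpow, Function.comp_def] using (f.continuous.tendsto x).comp hx
  have h2 : Tendsto (fun n => z ^ k n) atTop (𝓝 1) := by
    have := h1.div_const (f x)
    rw [div_self hx0] at this
    exact this.congr fun n => mul_div_cancel_right₀ _ hx0
  have h3 : Tendsto (fun n => ‖z‖ ^ k n) atTop (𝓝 1) := by
    simpa using h2.norm
  rw [mem_sphere_zero_iff_norm]
  rcases lt_trichotomy ‖z‖ 1 with h | h | h
  · have := (tendsto_pow_atTop_nhds_zero_of_lt_one (norm_nonneg z) h).comp hk.tendsto_atTop
    exact absurd (tendsto_nhds_unique this h3) zero_ne_one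
  · exact h
  · have := (tendsto_pow_atTop_atTop_of_one_lt h).comp hk.tendsto_atTop
    exact absurd h3 (not_tendsto_nhds_of_tendsto_atTop this 1)

variable [CompleteSpace X]

theorem leftFredholmSpectrum_subset (T : X →L[ℂ] X) :
    leftFredholmSpectrum T ⊆ leftEssentialSpectrum T :=
  fun _ hz ⟨_, hb⟩ => hz (.of_leftInvertible hb)

theorem isOpen_compl_essentialSpectrum (T : X →L[ℂ] X) : IsOpen (essentialSpectrum T)ᶜ := by
  rw [isOpen_iff_mem_nhds]
  intro z hz
  have h := isUnit_calkinMk_sub_smul (not_not.mp hz)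
  have h0 : Tendsto (fun w : ℂ => w - z) (𝓝 z) (𝓝 0) := by
    simpa using (continuous_id.sub continuous_const).tendsto (f := fun w : ℂ => w - z) z
  filter_upwards [h0.eventually h] with w hw
  rw [← sub_smul_one_sub] at hw
  exact not_not.mpr hw

/-- A point of the essential spectrum that is not in the left-Fredholm spectrum has a neighbourhood
on which all `T* - w` have an infinite-dimensional kernel. -/
theorem eventually_not_finiteDimensional {T : X →L[ℂ] X} {z : ℂ}
    (hz : z ∉ leftFredholmSpectrum T) (hz' : z ∈ essentialSpectrum T) :
    ∀ᶠ w in 𝓝 z, ¬ FiniteDimensional ℂ (dualOperator (T - w • 1)).ker := by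
  have h := (not_not.mp hz).eventually_isUnit
  have h0 : Tendsto (fun w : ℂ => w - z) (𝓝 z) (𝓝 0) := by
    simpa using (continuous_id.sub continuous_const).tendsto (f := fun w : ℂ => w - z) z
  filter_upwards [h0.eventually h] with w hw hfin
  rw [← sub_smul_one_sub] at hw
  exact hz' (hw hfin)

theorem leftFredholmSpectrum_inter_closure_nonempty {T : X →L[ℂ] X} {Ω : Set ℂ}
    (hΩ : IsConnected Ω) (hne : (Ω \ pointSpectrum (dualOperator T)).Nonempty)
    (h : (essentialSpectrum T ∩ closure Ω).Nonempty) :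
    (leftFredholmSpectrum T ∩ closure Ω).Nonempty := by
  by_contra hcon
  have hF : ∀ z ∈ closure Ω, z ∉ leftFredholmSpectrum T := fun z hz hzF => hcon ⟨z, hzF, hz⟩
  -- `V` and the complement of `σ_e` are disjoint open sets; if `σ_ℓF` missed the closure of `Ω`,
  -- they would disconnect it.
  let V : Set ℂ := {z | ∀ᶠ w in 𝓝 z, ¬ FiniteDimensional ℂ (dualOperator (T - w • 1)).ker}
  have hV : IsOpen V := isOpen_setOfPred_eventually_nhds
  have hdisj : ∀ z ∈ (essentialSpectrum T)ᶜ, z ∉ V := fun z hz hzV =>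
    hzV.self_of_nhds (finiteDimensional_ker_dualOperator (not_not.mp hz))
  have hcover : ∀ z ∈ closure Ω, z ∈ (essentialSpectrum T)ᶜ ∨ z ∈ V := fun z hz =>
    or_iff_not_imp_left.mpr fun hze =>
      eventually_not_finiteDimensional (hF z hz) (not_not.mp hze)
  obtain ⟨a, haΩ, ha⟩ := hne
  have haV : a ∉ V := fun h => h.self_of_nhds (finiteDimensional_ker_of_notMem_pointSpectrum ha)
  have haE : a ∈ (essentialSpectrum T)ᶜ := (hcover a (subset_closure haΩ)).resolve_right haV
  obtain ⟨b, hbE, hb⟩ := h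
  have hbV : b ∈ V := (hcover b hb).resolve_left (not_not.mpr hbE)
  obtain ⟨w, -, hwE, hwV⟩ := hΩ.closure.isPreconnected _ _ (isOpen_compl_essentialSpectrum T) hV
    hcover ⟨a, subset_closure haΩ, haE⟩ ⟨b, hb, hbV⟩
  exact hdisj w hwE hwV

theorem spectra_eq_of_interior_pointSpectrum_eq_empty {T : X →L[ℂ] X}
    (h : interior (pointSpectrum (dualOperator T)) = ∅) :
    leftEssentialSpectrum T = essentialSpectrum T ∧
      leftFredholmSpectrum T = essentialSpectrum T := by
  have hsub : essentialSpectrum T ⊆ leftFredholmSpectrum T := by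
    intro z hz
    by_contra hzF
    have hint : z ∈ interior (pointSpectrum (dualOperator T)) := by
      rw [mem_interior_iff_mem_nhds]
      filter_upwards [eventually_not_finiteDimensional hzF hz] with w hw
      by_contra hwp
      exact hw (finiteDimensional_ker_of_notMem_pointSpectrum hwp)
    rwa [h] at hint
  have h1 := leftFredholmSpectrum_subset T
  have h2 := leftEssentialSpectrum_subset T
  exact ⟨h2.antisymm (hsub.trans h1), (h1.trans h2).antisymm hsub⟩

end Spectra

end EssentialSpectrum

theorem mainTheorem5 {X : Type*} [NormedAddCommGroup X] [NormedSpace ℂ X] [CompleteSpace X]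
    (T : X →L[ℂ] X) :
    (∀ Ω : Set ℂ, IsOpen Ω → IsConnected Ω →
      (Ω \ EssentialSpectrum.pointSpectrum (EssentialSpectrum.dualOperator T)).Nonempty →
      ((EssentialSpectrum.leftEssentialSpectrum T ∩ closure Ω).Nonempty ↔
        (EssentialSpectrum.essentialSpectrum T ∩ closure Ω).Nonempty) ∧
      ((EssentialSpectrum.leftFredholmSpectrum T ∩ closure Ω).Nonempty ↔
        (EssentialSpectrum.essentialSpectrum T ∩ closure Ω).Nonempty)) ∧
    (interior (EssentialSpectrum.pointSpectrum (EssentialSpectrum.dualOperator T)) = ∅ →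
      EssentialSpectrum.leftEssentialSpectrum T = EssentialSpectrum.essentialSpectrum T ∧
      EssentialSpectrum.leftFredholmSpectrum T = EssentialSpectrum.essentialSpectrum T) ∧
    (EssentialSpectrum.IsRecurrent T →
      EssentialSpectrum.leftEssentialSpectrum T = EssentialSpectrum.essentialSpectrum T ∧
      EssentialSpectrum.leftFredholmSpectrum T = EssentialSpectrum.essentialSpectrum T) := by
  open EssentialSpectrum in
  have h1 := leftFredholmSpectrum_subset T
  have h2 := leftEssentialSpectrum_subset T
  refine ⟨fun Ω _ hΩ hne => ?_, spectra_eq_of_interior_pointSpectrum_eq_empty, fun hT => ?_⟩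
  · have h := leftFredholmSpectrum_inter_closure_nonempty hΩ hne
    exact ⟨⟨.mono (Set.inter_subset_inter_left _ h2),
        fun he => (h he).mono (Set.inter_subset_inter_left _ h1)⟩,
      ⟨.mono (Set.inter_subset_inter_left _ (h1.trans h2)), h⟩⟩
  · refine spectra_eq_of_interior_pointSpectrum_eq_empty (Set.subset_eq_empty ?_
      (interior_sphere (0 : ℂ) one_ne_zero))
    exact interior_mono (pointSpectrum_dualOperator_subset_sphere hT)
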